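/- Let $X=\{1,2,3\}$, let $X^*$ be the set of finite words over $X$ (the vertices of the rooted ternary tree), and let $a,t$ be the permutations of $X^*$, written as right actions, that fix the empty word and satisfy, for all $v\in X^*$, \[(1v)^a=2v,\quad (2v)^a=3v,\quad (3v)^a=1v,\qquad (1v)^t=1\,v^a,\quad (2v)^t=2\,v^{a^{-1}},\quad (3v)^t=3\,v^t.\] The Gupta--Sidki group $\Gamma$ is the group of permutations of $X^*$ generated by $a$ and $t$. For elements $x,y$ of a group put $[x,y]=x^{-1}y^{-1}xy$, $E_0(x,y)=x$ and $E_{c+1}(x,y)=[E_c(x,y),y]$ for $c\ge 0$. An element $h$ of a group $G$ is called an Engel element if for every $g\in G$ one has $E_c(g,h)=1$ for all sufficiently large $c$. Theorem. The only Engel element of the Gupta--Sidki group $\Gamma$ is the identity; that is, an element $h\in\Gamma$ is an Engel element if and only if $h=1$. -/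

import Mathlib

/-- The Engel words `E_c(x, y)`: `E_0(x, y) = x` and `E_{c+1}(x, y) = [E_c(x, y), y]`, with the
commutator convention `[u, y] = u⁻¹ y⁻¹ u y`. -/
def engelWord {G : Type*} [Group G] (x y : G) : ℕ → G
  | 0 => x
  | c + 1 => (engelWord x y c)⁻¹ * y⁻¹ * engelWord x y c * y

/-- `h` is an Engel element of `G`: for every `g` in `G`, the elements `E_c(g, h)` are trivial for
all sufficiently large `c`. -/
def IsEngelElement {G : Type*} [Group G] (h : G) : Prop :=
  ∀ g : G, ∃ N : ℕ, ∀ c : ℕ, N ≤ c → engelWord g h c = 1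

namespace GuptaSidki

/-- Finite words over a three-letter alphabet, that is, the vertices of the rooted ternary tree.
The letters `1, 2, 3` are represented by `0, 1, 2 : Fin 3`. -/
abbrev Word : Type := List (Fin 3)

/-- The transformation adding `k` (modulo 3) to the first letter of a word. -/
def rotFun (k : Fin 3) : Word → Word
  | [] => []
  | x :: v => (x + k) :: v

/-- The generator `a`, permuting the first letter cyclically:
`1v ↦ 2v`, `2v ↦ 3v`, `3v ↦ 1v`. -/
def a : Equiv.Perm Word where
  toFun := rotFun 1
  invFun := rotFun (-1)
  left_inv := by
    rintro (_ | ⟨x, v⟩) <;> simp [rotFun]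
  right_inv := by
    rintro (_ | ⟨x, v⟩) <;> simp [rotFun]

/-- The transformation determined by a permutation `s` of the words through
`1v ↦ 1 s(v)`, `2v ↦ 2 s⁻¹(v)`, and, recursively, `3v ↦ 3` followed by the image of `v` under the
transformation itself. -/
def spineFun (s : Equiv.Perm Word) : Word → Word
  | [] => []
  | 0 :: v => 0 :: s v
  | 1 :: v => 1 :: s⁻¹ v
  | 2 :: v => 2 :: spineFun s v

theorem spineFun_inv_spineFun (s : Equiv.Perm Word) (v : Word) :
    spineFun s⁻¹ (spineFun s v) = v := by
  induction v with
  | nil => rfl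
  | cons x v ih => fin_cases x <;> simp [spineFun, ih]

/-- The generator `t`: `1v ↦ 1 a(v)`, `2v ↦ 2 a⁻¹(v)`, `3v ↦ 3 t(v)`. -/
def t : Equiv.Perm Word where
  toFun := spineFun a
  invFun := spineFun a⁻¹
  left_inv := spineFun_inv_spineFun a
  right_inv := by
    intro v
    simpa using spineFun_inv_spineFun a⁻¹ v

/-- The Gupta–Sidki group `Γ`, generated by `a` and `t`. Transformations act on words from the
right, so `g * h` is "first `g`, then `h`": the product is opposite to that of
`Equiv.Perm Word`. -/
def Γ : Subgroup (Equiv.Perm Word)ᵐᵒᵖ :=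
  Subgroup.closure {MulOpposite.op a, MulOpposite.op t}

end GuptaSidki

/-! For every `h ≠ 1` in `Γ` the cube of `Γ'` embeds in `Γ'` so that conjugation by `h` becomes the
cyclic shift of the factors (`shifts_of_mem`). On this copy the Engel words with `h` are iterates of
D = `shiftCommutator` (`engelWord_shift`), so a triple in `Γ'` that no iterate of D kills is enough.
`recurrentTriple` has a self-reproducing section under D, hence D^c never kills it; its entries need
not lie in `Γ'`, but those of its third iterate do, because D³ is trivial on abelian groups of
exponent 3.

To get the shift, descend to a section of `h` that rotates the first letter. The section there of
its cube centralises a copy of `Γ'` (`IsWord.centralises`, by induction on the number of letters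
`t`), and conjugation carries that copy around the three letters. The copies stay in `Γ'` because
`Γ'` contains its own first-level cube (`diag_mem_derived`). -/

namespace GuptaSidki

open MulOpposite
open scoped commutatorElement

/-! ### Wreath decomposition of tree permutations and of the generators. -/

/-- Permutations of the words, multiplied as right actions. -/
abbrev TreePerm : Type := (Equiv.Perm Word)ᵐᵒᵖ

/-- The permutation acting by `f i` on the words below the letter `i`. -/
def diagPerm (f : Fin 3 → TreePerm) : Equiv.Perm Word where
  toFun
    | [] => []
    | i :: v => i :: (f i).unop v
  invFun
    | [] => []
    | i :: v => i :: (f i).unop⁻¹ v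
  left_inv := by rintro (_ | ⟨x, v⟩) <;> simp
  right_inv := by rintro (_ | ⟨x, v⟩) <;> simp

/-- The embedding of triples of permutations as permutations fixing the first letter. -/
def diag : (Fin 3 → TreePerm) →* TreePerm :=
  MonoidHom.mk' (fun f => op (diagPerm f)) fun f g => by
    apply unop_injective
    ext1 v
    rcases v with _ | ⟨x, v⟩ <;> rfl

/-- The cyclic rotation of the first letter by `k`. -/
def rot (k : Fin 3) : TreePerm :=
  op { toFun := rotFun k
       invFun := rotFun (-k)
       left_inv := by rintro (_ | ⟨x, v⟩) <;> simp [rotFun]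
       right_inv := by rintro (_ | ⟨x, v⟩) <;> simp [rotFun] }

@[simp] theorem unop_diag_nil (f : Fin 3 → TreePerm) : (diag f).unop [] = [] := rfl

@[simp] theorem unop_diag_cons (f : Fin 3 → TreePerm) (i : Fin 3) (v : Word) :
    (diag f).unop (i :: v) = i :: (f i).unop v := rfl

@[simp] theorem unop_rot_nil (k : Fin 3) : (rot k).unop [] = [] := rfl

@[simp] theorem unop_rot_cons (k i : Fin 3) (v : Word) :
    (rot k).unop (i :: v) = (i + k) :: v := rfl

theorem treePerm_ext {g h : TreePerm} (H : ∀ v, g.unop v = h.unop v) : g = h :=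
  unop_injective (Equiv.ext H)

theorem diag_injective : Function.Injective diag := by
  intro f g h
  funext i
  refine treePerm_ext fun v => ?_
  simpa using congrArg (fun x : TreePerm => x.unop (i :: v)) h

theorem rot_zero : rot 0 = 1 :=
  treePerm_ext fun v => by rcases v with _ | ⟨i, v⟩ <;> simp

theorem rot_add (k l : Fin 3) : rot (k + l) = rot k * rot l :=
  treePerm_ext fun v => by rcases v with _ | ⟨i, v⟩ <;> simp [add_assoc]

theorem rot_neg (k : Fin 3) : rot (-k) = (rot k)⁻¹ :=
  eq_inv_of_mul_eq_one_left (by rw [← rot_add, neg_add_cancel, rot_zero])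

theorem rot_mul_diag (k : Fin 3) (f : Fin 3 → TreePerm) :
    rot k * diag f = diag (fun i => f (i + k)) * rot k :=
  treePerm_ext fun v => by rcases v with _ | ⟨i, v⟩ <;> simp

theorem rot_conj_diag (k : Fin 3) (f : Fin 3 → TreePerm) :
    rot k * diag f * (rot k)⁻¹ = diag (fun i => f (i + k)) := by
  rw [rot_mul_diag, mul_inv_cancel_right]

/-- The generator `a` as a right action. -/
abbrev α : TreePerm := op a

/-- The generator `t` as a right action. -/
abbrev τ : TreePerm := op t

theorem rot_one : rot 1 = α := treePerm_ext fun v => by rcases v with _ | ⟨i, v⟩ <;> rfl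

theorem rot_two : rot 2 = α⁻¹ := by rw [← rot_one, ← rot_neg]; rfl

theorem tau_eq_diag : τ = diag ![α, α⁻¹, τ] := treePerm_ext fun v => by
  rcases v with _ | ⟨i, v⟩
  · rfl
  · fin_cases i <;> rfl

theorem alpha_conj_tau : α⁻¹ * τ * α = diag ![τ, α, α⁻¹] := by
  have := rot_conj_diag 2 ![α, α⁻¹, τ]
  rw [rot_two, ← tau_eq_diag, inv_inv] at this
  rw [this]
  congr 1
  funext i
  fin_cases i <;> rfl

theorem alpha_mul_alpha : α * α = α⁻¹ := by
  rw [← rot_two, ← rot_one, ← rot_add]; rfl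

theorem tau_mul_tau : τ * τ = τ⁻¹ := by
  refine eq_inv_of_mul_eq_one_left (treePerm_ext fun v => ?_)
  induction v with
  | nil => rfl
  | cons i v ih =>
    rw [tau_eq_diag, ← map_mul, ← map_mul, unop_diag_cons]
    fin_cases i
    · simp [alpha_mul_alpha, -op_mul]
    · have : α⁻¹ * α⁻¹ * α⁻¹ = 1 := by
        rw [← mul_inv_rev, alpha_mul_alpha, inv_inv, mul_inv_cancel]
      simp [this, -op_mul]
    · simpa using ih

theorem alpha_mem : α ∈ Γ := Subgroup.subset_closure (by simp)

theorem tau_mem : τ ∈ Γ := Subgroup.subset_closure (by simp)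

theorem rot_mem (k : Fin 3) : rot k ∈ Γ := by
  fin_cases k
  · exact rot_zero ▸ one_mem _
  · exact rot_one ▸ alpha_mem
  · exact rot_two ▸ inv_mem alpha_mem

/-! ### Words in the generators -/

/-- `IsWord n g` says that `g` is a product of copies of `a` and exactly `n` copies of `t`. -/
inductive IsWord : ℕ → TreePerm → Prop
  | one : IsWord 0 1
  | mul_alpha {n g} : IsWord n g → IsWord n (g * α)
  | mul_tau {n g} : IsWord n g → IsWord (n + 1) (g * τ)

theorem IsWord.mul {m n : ℕ} {g h : TreePerm} (hg : IsWord m g) (hh : IsWord n h) :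
    IsWord (m + n) (g * h) := by
  induction hh with
  | one => simpa using hg
  | mul_alpha _ ih => rw [← mul_assoc]; exact ih.mul_alpha
  | mul_tau _ ih => rw [← mul_assoc]; exact ih.mul_tau

theorem IsWord.alpha : IsWord 0 α := one_mul α ▸ IsWord.one.mul_alpha

theorem IsWord.tau : IsWord 1 τ := one_mul τ ▸ IsWord.one.mul_tau

theorem IsWord.alpha_inv : IsWord 0 α⁻¹ := alpha_mul_alpha ▸ IsWord.alpha.mul_alpha

theorem IsWord.tau_inv : IsWord 2 τ⁻¹ := tau_mul_tau ▸ IsWord.tau.mul_tau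

theorem IsWord.mem {n : ℕ} {g : TreePerm} (hg : IsWord n g) : g ∈ Γ := by
  induction hg with
  | one => exact one_mem _
  | mul_alpha _ ih => exact mul_mem ih alpha_mem
  | mul_tau _ ih => exact mul_mem ih tau_mem

/-- Positive words suffice because both generators have order 3. -/
theorem exists_isWord {g : TreePerm} (hg : g ∈ Γ) : ∃ n, IsWord n g := by
  induction hg using Subgroup.closure_induction'' with
  | mem x hx =>
    rcases hx with rfl | rfl
    exacts [⟨_, .alpha⟩, ⟨_, .tau⟩]
  | inv_mem x hx =>
    rcases hx with rfl | rfl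
    exacts [⟨_, .alpha_inv⟩, ⟨_, .tau_inv⟩]
  | one => exact ⟨_, .one⟩
  | mul x y _ _ hx hy =>
    obtain ⟨m, hm⟩ := hx
    obtain ⟨n, hn⟩ := hy
    exact ⟨_, hm.mul hn⟩

theorem IsWord.eq_rot {g : TreePerm} (hg : IsWord 0 g) : ∃ k, g = rot k := by
  generalize hn : 0 = n at hg
  induction hg with
  | one => exact ⟨0, rot_zero.symm⟩
  | mul_alpha _ ih =>
    obtain ⟨k, rfl⟩ := ih hn
    exact ⟨k + 1, by rw [rot_add, rot_one]⟩
  | mul_tau _ _ => omega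

/-- `HasRoot k g` says that `g` adds `k` to the first letter of every word. -/
def HasRoot (k : Fin 3) (g : TreePerm) : Prop := ∃ f, g = diag f * rot k

theorem HasRoot.mul {k l : Fin 3} {g h : TreePerm} (hg : HasRoot k g) (hh : HasRoot l h) :
    HasRoot (k + l) (g * h) := by
  obtain ⟨f, rfl⟩ := hg
  obtain ⟨f', rfl⟩ := hh
  refine ⟨f * fun i => f' (i + k), ?_⟩
  rw [map_mul, rot_add, mul_assoc, ← mul_assoc (rot k), rot_mul_diag]
  simp only [mul_assoc]

theorem hasRoot_diag (f : Fin 3 → TreePerm) : HasRoot 0 (diag f) := ⟨f, by simp [rot_zero]⟩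

theorem hasRoot_rot (k : Fin 3) : HasRoot k (rot k) := ⟨1, by simp⟩

theorem HasRoot.eq {k l : Fin 3} {g : TreePerm} (h : HasRoot k g) (h' : HasRoot l g) : k = l := by
  obtain ⟨f, rfl⟩ := h
  obtain ⟨f', h'⟩ := h'
  simpa using congrArg (fun x : TreePerm => (x.unop [0]).head?) h'

/-- The sections of a word at the first level share the letters `t` among themselves, and their
rotations cancel. -/
theorem IsWord.exists_sections {n : ℕ} {g : TreePerm} (hg : IsWord n g) :
    ∃ (f : Fin 3 → TreePerm) (k : Fin 3) (N : Fin 3 → ℕ) (r : Fin 3 → Fin 3),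
      g = diag f * rot k ∧ (∀ i, IsWord (N i) (f i)) ∧ N 0 + N 1 + N 2 = n ∧
        (∀ i, HasRoot (r i) (f i)) ∧ r 0 + r 1 + r 2 = 0 := by
  induction hg with
  | one =>
    exact ⟨1, 0, 0, 0, by simp [rot_zero], fun _ => .one, rfl,
      fun _ => ⟨1, by simp [rot_zero]⟩, rfl⟩
  | mul_alpha _ ih =>
    obtain ⟨f, k, N, r, rfl, hf⟩ := ih
    exact ⟨f, k + 1, N, r, by rw [rot_add, rot_one, mul_assoc], hf⟩
  | mul_tau _ ih =>
    obtain ⟨f, k, N, r, rfl, hN, hn, hr, hr0⟩ := ih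
    -- The sections of `τ` rotate by 1, 2, 0, with sum zero, and only the last contains a `t`.
    have hroot : ∀ i : Fin 3, HasRoot (![1, 2, 0] i) ((![α, α⁻¹, τ] : Fin 3 → TreePerm) i) := by
      intro i
      fin_cases i
      · exact rot_one ▸ hasRoot_rot 1
      · exact rot_two ▸ hasRoot_rot 2
      · exact tau_eq_diag ▸ hasRoot_diag _
    have hword : ∀ i : Fin 3, IsWord (![0, 0, 1] i) ((![α, α⁻¹, τ] : Fin 3 → TreePerm) i) := by
      intro i
      fin_cases i
      exacts [.alpha, .alpha_inv, .tau]
    refine ⟨f * fun i => ![α, α⁻¹, τ] (i + k), k, fun i => N i + ![0, 0, 1] (i + k),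
      fun i => r i + ![1, 2, 0] (i + k), ?_, fun i => (hN i).mul (hword _), ?_,
      fun i => (hr i).mul (hroot _), ?_⟩
    · rw [mul_assoc]
      nth_rewrite 1 [tau_eq_diag]
      rw [rot_mul_diag, ← mul_assoc, ← map_mul]
    · fin_cases k <;> simp <;> omega
    · have : r 0 + ![1, 2, 0] (0 + k) + (r 1 + ![1, 2, 0] (1 + k)) + (r 2 + ![1, 2, 0] (2 + k))
          = (r 0 + r 1 + r 2) + (![1, 2, 0] k + ![1, 2, 0] (1 + k) + ![1, 2, 0] (2 + k)) := by
        rw [zero_add]; abel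
      rw [this, hr0]
      fin_cases k <;> rfl

/-! ### The derived subgroup contains its own first-level cube -/

/-- The derived subgroup of the Gupta–Sidki group. -/
abbrev Γ' : Subgroup TreePerm := ⁅Γ, Γ⁆

theorem derived_le : Γ' ≤ Γ :=
  Subgroup.commutator_le.2 fun _ hg _ hh =>
    mul_mem (mul_mem (mul_mem hg hh) (inv_mem hg)) (inv_mem hh)

theorem conj_mem_derived {g x : TreePerm} (hg : g ∈ Γ) (hx : x ∈ Γ') : g * x * g⁻¹ ∈ Γ' := by
  have : ⁅g, x⁆ ∈ Γ' := Subgroup.commutator_mem_commutator hg (derived_le hx)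
  simpa [commutatorElement_def] using mul_mem this hx

theorem conj_inv_mem_derived {g x : TreePerm} (hg : g ∈ Γ) (hx : x ∈ Γ') : g⁻¹ * x * g ∈ Γ' := by
  simpa using conj_mem_derived (inv_mem hg) hx

/-- The derived subgroup lies in every subgroup that is normalised by the group and contains the
commutator of the generators. -/
theorem derived_le_of_mem {L : Subgroup TreePerm} (hL : ∀ g ∈ Γ, ∀ x ∈ L, g * x * g⁻¹ ∈ L)
    (h : ⁅α, τ⁆ ∈ L) : Γ' ≤ L := by
  have key : ∀ y : TreePerm, (∀ x ∈ ({α, τ} : Set TreePerm), ⁅x, y⁆ ∈ L) →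
      ∀ x ∈ Γ, ⁅x, y⁆ ∈ L := by
    intro y hy x hx
    induction hx using Subgroup.closure_induction with
    | mem x hx => exact hy x hx
    | one => simp
    | mul u v hu hv ihu ihv =>
      have : ⁅u * v, y⁆ = u * ⁅v, y⁆ * u⁻¹ * ⁅u, y⁆ := by simp only [commutatorElement_def]; group
      rw [this]
      exact mul_mem (hL u hu _ ihv) ihu
    | inv u hu ihu =>
      have : ⁅u⁻¹, y⁆ = u⁻¹ * ⁅u, y⁆⁻¹ * u⁻¹⁻¹ := by simp only [commutatorElement_def]; group
      rw [this]
      exact hL _ (inv_mem hu) _ (inv_mem ihu)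
  have h' : ⁅τ, α⁆ ∈ L := by rw [← commutatorElement_inv]; exact inv_mem h
  -- `key` extends one argument from generators to the group; inverting the commutator swaps the
  -- arguments, so two uses suffice.
  refine Subgroup.commutator_le.2 fun x hx y hy => key y (fun z hz => ?_) x hx
  rw [← commutatorElement_inv]
  refine inv_mem (key z (fun w hw => ?_) y hy)
  rcases hz with rfl | rfl <;> rcases hw with rfl | rfl <;> simp [h, h', -op_mul]

/-- `τ` and its conjugate by `α` have first sections `α` and `τ`. -/
theorem exists_diag_mem {g : TreePerm} (hg : g ∈ Γ) : ∃ f, diag f ∈ Γ ∧ f 0 = g := by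
  induction hg using Subgroup.closure_induction with
  | mem x hx =>
    rcases hx with rfl | rfl
    · exact ⟨_, tau_eq_diag ▸ tau_mem, rfl⟩
    · exact ⟨_, alpha_conj_tau ▸ mul_mem (mul_mem (inv_mem alpha_mem) tau_mem) alpha_mem, rfl⟩
  | one => exact ⟨1, by simp, rfl⟩
  | mul x y _ _ hx hy =>
    obtain ⟨f, hf, rfl⟩ := hx
    obtain ⟨f', hf', rfl⟩ := hy
    exact ⟨f * f', by rw [map_mul]; exact mul_mem hf hf', rfl⟩
  | inv x _ hx =>
    obtain ⟨f, hf, rfl⟩ := hx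
    exact ⟨f⁻¹, by rw [map_inv]; exact inv_mem hf, rfl⟩

/-- The embedding of a permutation as acting on the words below the letter `i`. -/
def diagSingle (i : Fin 3) : TreePerm →* TreePerm :=
  diag.comp (MonoidHom.mulSingle (fun _ : Fin 3 => TreePerm) i)

theorem diagSingle_apply (i : Fin 3) (x : TreePerm) :
    diagSingle i x = diag (Pi.mulSingle i x) := rfl

/-- By `exists_diag_mem` the preimage of `Γ'` is normalised by `Γ`, so it need only contain `⁅α,
τ⁆`. Two conjugate elements whose trivial sections sit at different letters have a commutator
supported at letter 0 alone. -/
theorem diag_mulSingle_zero_mem {x : TreePerm} (hx : x ∈ Γ') :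
    diag (Pi.mulSingle 0 x) ∈ Γ' := by
  have normalised : ∀ g ∈ Γ, ∀ x ∈ Γ'.comap (diagSingle 0), g * x * g⁻¹ ∈
      Γ'.comap (diagSingle 0) := by
    intro g hg x hx
    obtain ⟨f, hf, rfl⟩ := exists_diag_mem hg
    have : diag (Pi.mulSingle 0 (f 0 * x * (f 0)⁻¹))
        = diag f * diag (Pi.mulSingle 0 x) * (diag f)⁻¹ := by
      rw [← map_inv, ← map_mul, ← map_mul]
      congr 1
      funext i
      fin_cases i <;> simp
    rw [Subgroup.mem_comap, diagSingle_apply] at hx ⊢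
    rw [this]
    exact conj_mem_derived hf hx
  refine derived_le_of_mem normalised ?_ hx
  have h0 : τ * (α⁻¹ * τ * α) = diag ![α * τ, 1, τ * α⁻¹] := by
    nth_rewrite 1 [tau_eq_diag]
    rw [alpha_conj_tau, ← map_mul]
    congr 1
    funext i
    fin_cases i <;> simp [-op_mul]
  have h1 : α⁻¹ * (τ * (α⁻¹ * τ * α)) * α = diag ![τ * α⁻¹, α * τ, 1] := by
    have := rot_conj_diag 2 ![α * τ, 1, τ * α⁻¹]
    rw [rot_two, ← h0, inv_inv] at this
    rw [this]
    congr 1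
    funext i
    fin_cases i <;> rfl
  have h2 : diag (Pi.mulSingle 0 ⁅α, τ⁻¹⁆) ∈ Γ' := by
    have hm : τ * (α⁻¹ * τ * α) ∈ Γ :=
      mul_mem tau_mem (mul_mem (mul_mem (inv_mem alpha_mem) tau_mem) alpha_mem)
    have := Subgroup.commutator_mem_commutator hm
      (mul_mem (mul_mem (inv_mem alpha_mem) hm) alpha_mem)
    rw [h1, h0, ← map_commutatorElement] at this
    convert this using 2
    funext i
    fin_cases i
    · have : ⁅α * τ, τ * α⁻¹⁆ = α * (τ * τ) * α⁻¹ * (τ * τ)⁻¹ := by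
        simp only [commutatorElement_def]; group
      change ⁅α, τ⁻¹⁆ = ⁅α * τ, τ * α⁻¹⁆
      rw [this, tau_mul_tau, commutatorElement_def]
    · simp [commutatorElement_def]
    · simp [commutatorElement_def]
  have h3 : ⁅α, τ⁆ = τ * ⁅α, τ⁻¹⁆⁻¹ * τ⁻¹ := by
    simp only [commutatorElement_def]; group
  rw [h3]
  exact normalised _ tau_mem _ (inv_mem h2)

theorem diag_mem_derived {f : Fin 3 → TreePerm} (hf : ∀ i, f i ∈ Γ') : diag f ∈ Γ' := by
  have hsingle : ∀ i, diag (Pi.mulSingle i (f i)) ∈ Γ' := by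
    intro i
    have : diag (Pi.mulSingle i (f i))
        = rot (-i) * diag (Pi.mulSingle 0 (f i)) * (rot (-i))⁻¹ := by
      rw [rot_conj_diag]
      congr 1
      funext j
      by_cases h : j = i
      · subst h; simp
      · rw [Pi.mulSingle_eq_of_ne h, Pi.mulSingle_eq_of_ne]
        rwa [← sub_eq_add_neg, sub_ne_zero]
    rw [this]
    exact conj_mem_derived (rot_mem _) (diag_mulSingle_zero_mem (hf i))
  have : f = Pi.mulSingle 0 (f 0) * Pi.mulSingle 1 (f 1) * Pi.mulSingle 2 (f 2) := by
    funext i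
    fin_cases i <;> simp
  rw [this, map_mul, map_mul]
  exact mul_mem (mul_mem (hsingle 0) (hsingle 1)) (hsingle 2)

/-! ### Copies of the cyclic shift -/

/-- The derived subgroup embeds in itself with image centralised by `h`. -/
def Centralises (h : TreePerm) : Prop :=
  ∃ ψ : TreePerm →* TreePerm, Function.Injective ψ ∧ (∀ x ∈ Γ', ψ x ∈ Γ') ∧
    ∀ x, h⁻¹ * ψ x * h = ψ x

/-- The cube of the derived subgroup embeds in the derived subgroup so that conjugation by `h`
is the cyclic shift of the three factors. -/
def Shifts (h : TreePerm) : Prop :=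
  ∃ φ : (Fin 3 → TreePerm) →* TreePerm, Function.Injective φ ∧
    (∀ x, (∀ i, x i ∈ Γ') → φ x ∈ Γ') ∧ ∀ x, h⁻¹ * φ x * h = φ fun i => x (i - 1)

theorem Shifts.centralises {h : TreePerm} (hh : Shifts h) : Centralises h := by
  obtain ⟨φ, hφ, hmem, hconj⟩ := hh
  exact ⟨φ.comp (Pi.constMonoidHom (Fin 3) TreePerm),
    hφ.comp fun x y hxy => congrFun hxy 0, fun x hx => hmem _ fun _ => hx, fun x => hconj _⟩

theorem centralises_one : Centralises 1 :=
  ⟨MonoidHom.id _, fun _ _ h => h, fun _ hx => hx, fun x => by simp⟩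

theorem diagSingle_injective (i : Fin 3) : Function.Injective (diagSingle i) :=
  fun _ _ h => Pi.mulSingle_injective i (diag_injective h)

theorem diagSingle_mem (i : Fin 3) {x : TreePerm} (hx : x ∈ Γ') : diagSingle i x ∈ Γ' := by
  refine diag_mem_derived fun j => ?_
  rw [MonoidHom.mulSingle_apply]
  by_cases h : j = i
  · subst h; simpa using hx
  · rw [Pi.mulSingle_eq_of_ne h]; exact one_mem _

theorem diag_conj_diagSingle (f : Fin 3 → TreePerm) (i : Fin 3) (x : TreePerm) :
    (diag f)⁻¹ * diagSingle i x * diag f = diagSingle i ((f i)⁻¹ * x * f i) := by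
  rw [diagSingle_apply, diagSingle_apply, ← map_inv, ← map_mul, ← map_mul]
  congr 1
  funext j
  by_cases h : j = i
  · subst h; simp
  · simp [Pi.mulSingle_eq_of_ne h]

/-- The copy is placed below the letter `i`, where `diag f` acts only through `f i`. -/
theorem Centralises.diag {f : Fin 3 → TreePerm} {i : Fin 3} (h : Centralises (f i)) :
    Centralises (diag f) := by
  obtain ⟨ψ, hψ, hmem, hconj⟩ := h
  refine ⟨(diagSingle i).comp ψ, (diagSingle_injective i).comp hψ,
    fun x hx => diagSingle_mem i (hmem x hx), fun x => ?_⟩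
  rw [MonoidHom.comp_apply, diag_conj_diagSingle, hconj]

theorem Shifts.diag {f : Fin 3 → TreePerm} {i : Fin 3} (h : Shifts (f i)) : Shifts (diag f) := by
  obtain ⟨φ, hφ, hmem, hconj⟩ := h
  refine ⟨(diagSingle i).comp φ, (diagSingle_injective i).comp hφ,
    fun x hx => diagSingle_mem i (hmem x hx), fun x => ?_⟩
  rw [MonoidHom.comp_apply, diag_conj_diagSingle, hconj, MonoidHom.comp_apply]

theorem eq_one_or_eq_two : ∀ k : Fin 3, k ≠ 0 → k = 1 ∨ k = 2 := by decide

theorem add_self_ne_zero : ∀ k : Fin 3, k ≠ 0 → k + k ≠ 0 := by decide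

theorem mul_self_eq_one : ∀ k : Fin 3, k ≠ 0 → k * k = 1 := by decide

theorem zero_sub_eq_add_self : ∀ k : Fin 3, 0 - k = k + k := by decide

theorem eq_zero_or_eq_or_eq_add_self :
    ∀ k : Fin 3, k ≠ 0 → ∀ i, i = 0 ∨ i = k ∨ i = k + k := by decide

/-- If `h` rotates the first letter and the section of `h ^ 3` at the first letter centralises a
copy of the derived subgroup, then `h` shifts three copies of it. -/
theorem Centralises.shifts {f : Fin 3 → TreePerm} {k : Fin 3} (hk : k ≠ 0) (hf : ∀ i, f i ∈ Γ)
    (h : Centralises (f 0 * f k * f (k + k))) : Shifts (GuptaSidki.diag f * rot k) := by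
  obtain ⟨ψ, hψ, hmem, hconj⟩ := h
  -- `c i` carries the first factor along the orbit of the first letter to the factor `i`
  obtain ⟨c, hc, hc0, hc1, hc2⟩ : ∃ c : Fin 3 → TreePerm, (∀ i, c i ∈ Γ) ∧
      c 0 = 1 ∧ c k = f 0 ∧ c (k + k) = f 0 * f k := by
    refine ⟨fun i => if i = 0 then 1 else if i = k then f 0 else f 0 * f k, ?_, ?_, ?_, ?_⟩
    · intro i
      dsimp only
      split_ifs
      exacts [one_mem _, hf 0, mul_mem (hf 0) (hf k)]
    · simp
    · simp [hk]
    · have h1 : k + k ≠ 0 := add_self_ne_zero k hk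
      simp [h1, hk]
  have hkk := mul_self_eq_one k hk
  -- Since `k * k = 1`, the index `k * i` turns the shift by `k` into the shift by 1.
  refine ⟨GuptaSidki.diag.comp
    { toFun := fun x i => (c i)⁻¹ * ψ (x (k * i)) * c i
      map_one' := by funext i; simp
      map_mul' := fun x y => by funext i; simp [mul_assoc] }, ?_, ?_, ?_⟩
  · refine diag_injective.comp fun x y hxy => funext fun i => hψ ?_
    have := congrFun hxy (k * i)
    simp only [MonoidHom.coe_mk, OneHom.coe_mk, ← mul_assoc k k, hkk, one_mul] at this
    exact mul_left_cancel (mul_right_cancel this)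
  · exact fun x hx => diag_mem_derived fun i => conj_inv_mem_derived (hc i) (hmem _ (hx _))
  · intro x
    have hconj' : ∀ p : Fin 3 → TreePerm, (GuptaSidki.diag f * rot k)⁻¹ * GuptaSidki.diag p *
        (GuptaSidki.diag f * rot k) =
        GuptaSidki.diag fun i => (f (i - k))⁻¹ * p (i - k) * f (i - k) := by
      intro p
      have := rot_conj_diag (-k) (f⁻¹ * p * f)
      simp only [rot_neg, inv_inv, map_mul, map_inv] at this
      simp only [mul_inv_rev, mul_assoc, sub_eq_add_neg] at this ⊢
      exact this
    rw [MonoidHom.comp_apply, hconj', MonoidHom.comp_apply]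
    congr 1
    funext i
    have hi := eq_zero_or_eq_or_eq_add_self k hk i
    simp only [MonoidHom.coe_mk, OneHom.coe_mk, mul_sub, hkk]
    rcases hi with rfl | rfl | rfl
    -- Here the orbit closes up: the accumulated conjugator is `f 0 * f k * f (k + k)`, which
    -- centralises the image of `ψ`.
    · have h0 := zero_sub_eq_add_self k
      rw [h0, hc2, hc0, inv_one, one_mul, mul_one]
      refine Eq.trans ?_ (hconj (x (k * 0 - 1)))
      simp only [mul_inv_rev, mul_assoc]
    · simp [hc0, hc1]
    · rw [add_sub_cancel_right, hc2, hc1]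
      simp only [mul_inv_rev, mul_assoc]

theorem IsWord.centralises {n : ℕ} : ∀ {h : TreePerm}, IsWord n h → Centralises h := by
  induction n using Nat.strong_induction_on with
  | _ n ih =>
    have stab : ∀ {h : TreePerm}, IsWord n h → HasRoot 0 h → Centralises h := by
      intro h hh h0
      rcases n.eq_zero_or_pos with rfl | hn
      · obtain ⟨k, rfl⟩ := hh.eq_rot
        rw [(hasRoot_rot k).eq h0, rot_zero]
        exact centralises_one
      · obtain ⟨f, k, N, r, rfl, hN, hsum, -, -⟩ := hh.exists_sections
        obtain rfl : k = 0 := HasRoot.eq ⟨f, rfl⟩ h0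
        -- The counts sum to `n > 0`, so two of them cannot both reach `n`.
        obtain ⟨i, hi⟩ : ∃ i, N i < n := by
          by_contra! hc
          have := hc 0
          have := hc 1
          omega
        rw [rot_zero, mul_one]
        exact (ih _ hi (hN i)).diag
    intro h hh
    obtain ⟨f, k, N, r, rfl, hN, hsum, hr, hr0⟩ := hh.exists_sections
    by_cases hk : k = 0
    · exact stab hh (hk ▸ ⟨f, rfl⟩)
    -- The section of the cube again has `n` letters `t`, out of reach of `ih`; but its rotation is
    -- `r 0 + r 1 + r 2 = 0`, so `stab` applies.
    · refine (Centralises.shifts hk (fun i => (hN i).mem) (stab ?_ ?_)).centralises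
      · have : N 0 + N k + N (k + k) = n := by
          rcases eq_one_or_eq_two k hk with rfl | rfl
          · exact hsum
          · exact (add_right_comm _ _ _).trans hsum
        exact this ▸ ((hN 0).mul (hN k)).mul (hN (k + k))
      · have h0 : r 0 + r k + r (k + k) = 0 := by
          rcases eq_one_or_eq_two k hk with rfl | rfl
          · exact hr0
          · exact (add_right_comm _ _ _).trans hr0
        have := ((hr 0).mul (hr k)).mul (hr (k + k))
        rwa [h0] at this

/-- Following a moved word down the tree leads to a section that rotates its first letter. -/
theorem shifts_of_mem {h : TreePerm} (hh : h ∈ Γ) (h1 : h ≠ 1) : Shifts h := by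
  obtain ⟨v, hv⟩ : ∃ v, h.unop v ≠ v := by
    by_contra! hc
    exact h1 (treePerm_ext hc)
  clear h1
  induction v generalizing h with
  | nil =>
    obtain ⟨n, hn⟩ := exists_isWord hh
    obtain ⟨f, k, -, -, rfl, -⟩ := hn.exists_sections
    simp at hv
  | cons i v ih =>
    obtain ⟨n, hn⟩ := exists_isWord hh
    obtain ⟨f, k, N, r, rfl, hN, -⟩ := hn.exists_sections
    by_cases hk : k = 0
    · subst hk
      rw [rot_zero, mul_one] at hv ⊢
      exact (ih (hN i).mem (by simpa using hv)).diag
    · obtain ⟨m, hm⟩ := exists_isWord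
        (mul_mem (mul_mem (hN 0).mem (hN k).mem) (hN (k + k)).mem)
      exact hm.centralises.shifts hk fun i => (hN i).mem

/-! ### A triple on which the shift is not nilpotent -/

section ShiftCommutator

variable {G H : Type*} [Group G] [Group H]

/-- The commutator of a triple with the cyclic shift. -/
def shiftCommutator (x : Fin 3 → G) : Fin 3 → G := fun i => (x i)⁻¹ * x (i - 1)

theorem map_shiftCommutator (f : G →* H) (x : Fin 3 → G) :
    shiftCommutator (fun i => f (x i)) = fun i => f (shiftCommutator x i) := by
  funext i
  simp [shiftCommutator]

theorem map_iterate_shiftCommutator (f : G →* H) (c : ℕ) (x : Fin 3 → G) :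
    shiftCommutator^[c] (fun i => f (x i)) = fun i => f (shiftCommutator^[c] x i) := by
  induction c generalizing x with
  | zero => rfl
  | succ c ih => rw [Function.iterate_succ_apply, map_shiftCommutator, ih]; rfl

theorem iterate_shiftCommutator_shift (c : ℕ) (x : Fin 3 → G) :
    shiftCommutator^[c] (fun i => x (i - 1)) = fun i => shiftCommutator^[c] x (i - 1) := by
  induction c generalizing x with
  | zero => rfl
  | succ c ih => rw [Function.iterate_succ_apply, Function.iterate_succ_apply, ← ih]; rfl

/-- With σ the shift, (σ - 1)³ = 3σ - 3σ² because σ³ = 1. -/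
theorem shiftCommutator_cube_eq_one {C : Type*} [CommGroup C] {x : Fin 3 → C}
    (hx : ∀ i, x i * x i * x i = 1) (i : Fin 3) : shiftCommutator^[3] x i = 1 := by
  -- The identity is proved additively, for `abel`, and read in `Additive C`.
  have additive : ∀ {B : Type _} [AddCommGroup B] (u v w : B),
      -(-(-u + v) + (-v + w)) + (-(-v + w) + (-w + u)) = v + v + v + -(w + w + w) := by
    intros
    abel
  have hi : i - 1 - 1 - 1 = i := by revert i; decide
  have := additive (B := Additive C) (x i) (x (i - 1)) (x (i - 1 - 1))
  have key : shiftCommutator^[3] x i = x (i - 1) * x (i - 1) * x (i - 1) *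
      (x (i - 1 - 1) * x (i - 1 - 1) * x (i - 1 - 1))⁻¹ := by
    simp only [Function.iterate_succ_apply, Function.iterate_zero_apply, shiftCommutator, hi]
    exact this
  rw [key, hx, hx, inv_one, mul_one]

end ShiftCommutator

/-- A triple that reappears, up to a shift, in the third sections of its commutator with the
shift. -/
def recurrentTriple : Fin 3 → TreePerm := ![α * τ, τ * α, τ⁻¹ * α * τ⁻¹]

theorem exists_shiftCommutator_recurrentTriple : ∃ q : Fin 3 → Fin 3 → TreePerm,
    shiftCommutator recurrentTriple = (fun i => diag (q i)) ∧
      ∀ i, q i 2 = recurrentTriple (i - 1) := by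
  have hα := alpha_conj_tau
  have hτ := tau_eq_diag
  set d : Fin 3 → TreePerm := ![α, α⁻¹, τ] with hd
  set e : Fin 3 → TreePerm := ![τ, α, α⁻¹] with he
  -- The commutators, written in `τ` and `α⁻¹ * τ * α`, whose section triples are `d` and `e`.
  refine ⟨![d⁻¹ * e⁻¹ * d⁻¹, e⁻¹ * d, d * e⁻¹], ?_, ?_⟩
  · funext i
    fin_cases i
    · change (α * τ)⁻¹ * (τ⁻¹ * α * τ⁻¹) = diag (d⁻¹ * e⁻¹ * d⁻¹)
      rw [map_mul, map_mul, map_inv, map_inv, ← hα, ← hτ]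
      group
    · change (τ * α)⁻¹ * (α * τ) = diag (e⁻¹ * d)
      rw [map_mul, map_inv, ← hα, ← hτ]
      group
    · change (τ⁻¹ * α * τ⁻¹)⁻¹ * (τ * α) = diag (d * e⁻¹)
      rw [map_mul, map_inv, ← hα, ← hτ]
      have : (τ⁻¹ * α * τ⁻¹)⁻¹ * (τ * α) = τ * α⁻¹ * (τ * τ) * α := by group
      rw [this, tau_mul_tau]
      group
  · intro i
    fin_cases i
    · change τ⁻¹ * α⁻¹⁻¹ * τ⁻¹ = τ⁻¹ * α * τ⁻¹
      rw [inv_inv]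
    · change α⁻¹⁻¹ * τ = α * τ
      rw [inv_inv]
    · change τ * α⁻¹⁻¹ = τ * α
      rw [inv_inv]

/-- The sections at the last letter of the iterate `c + 1` form the iterate `c`, shifted, so
triviality would descend to `c = 0`. -/
theorem iterate_shiftCommutator_recurrentTriple_ne_one (c : ℕ) :
    shiftCommutator^[c] recurrentTriple ≠ 1 := by
  induction c with
  | zero =>
    intro h
    have := congrArg (fun x : TreePerm => (x.unop [0]).head?) (congrFun h 0)
    revert this
    decide
  | succ c ih =>
    intro h
    obtain ⟨q, hq, hq2⟩ := exists_shiftCommutator_recurrentTriple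
    rw [Function.iterate_succ_apply, hq, map_iterate_shiftCommutator diag c q] at h
    refine ih (funext fun i => ?_)
    have h1 : shiftCommutator^[c] q (i + 1) 2 = 1 :=
      congrFun (diag_injective ((congrFun h (i + 1)).trans (map_one diag).symm)) 2
    have h2 := congrFun (map_iterate_shiftCommutator
      (Pi.evalMonoidHom (fun _ : Fin 3 => TreePerm) 2) c q) (i + 1)
    simp only [Pi.evalMonoidHom_apply, hq2, h1, iterate_shiftCommutator_shift,
      add_sub_cancel_right] at h2
    exact h2

/-- The abelianization of `Γ` is generated by elements of order dividing 3, so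
`shiftCommutator_cube_eq_one` applies there. -/
theorem shiftCommutator_cube_recurrentTriple_mem (i : Fin 3) : shiftCommutator^[3] recurrentTriple i ∈ Γ' := by
  obtain ⟨A, hA⟩ : ∃ A : Γ, Γ.subtype A = α := ⟨⟨α, alpha_mem⟩, rfl⟩
  obtain ⟨T, hT⟩ : ∃ T : Γ, Γ.subtype T = τ := ⟨⟨τ, tau_mem⟩, rfl⟩
  have hA3 : A * A = A⁻¹ := Γ.subtype_injective (by rw [map_mul, map_inv, hA, alpha_mul_alpha])
  have hT3 : T * T = T⁻¹ := Γ.subtype_injective (by rw [map_mul, map_inv, hT, tau_mul_tau])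
  let x : Fin 3 → Γ := ![A * T, T * A, T⁻¹ * A * T⁻¹]
  have hx : recurrentTriple = fun i => Γ.subtype (x i) := by
    funext i
    fin_cases i <;> simp [x, recurrentTriple, ← hA, ← hT, -op_mul]
  have hker : Abelianization.of (shiftCommutator^[3] x i) = 1 := by
    rw [← congrFun (map_iterate_shiftCommutator Abelianization.of 3 x) i]
    refine shiftCommutator_cube_eq_one (fun i => ?_) i
    have hA' : (Abelianization.of A) ^ 3 = 1 := by
      rw [← map_pow, pow_succ, pow_two, hA3, inv_mul_cancel, map_one]
    have hT' : (Abelianization.of T) ^ 3 = 1 := by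
      rw [← map_pow, pow_succ, pow_two, hT3, inv_mul_cancel, map_one]
    rw [← pow_two, ← pow_succ]
    fin_cases i <;> simp [x, mul_pow, hA', hT']
  rw [hx, map_iterate_shiftCommutator Γ.subtype 3 x]
  exact Γ.map_subtype_commutator.le
    (Subgroup.mem_map_of_mem _ ((Abelianization.ker_of Γ).le hker))

/-! ### Engel words along the shift and the conclusion. -/

theorem engelWord_shift {h : TreePerm} {φ : (Fin 3 → TreePerm) →* TreePerm}
    (hφ : ∀ x, h⁻¹ * φ x * h = φ fun i => x (i - 1)) (x : Fin 3 → TreePerm) (c : ℕ) :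
    engelWord (φ x) h c = φ (shiftCommutator^[c] x) := by
  induction c with
  | zero => rfl
  | succ c ih =>
    rw [engelWord, ih, mul_assoc, mul_assoc, ← mul_assoc h⁻¹, hφ, ← map_inv, ← map_mul,
      Function.iterate_succ_apply']
    rfl

end GuptaSidki

theorem map_engelWord {G H : Type*} [Group G] [Group H] (f : G →* H) (x y : G) (c : ℕ) :
    f (engelWord x y c) = engelWord (f x) (f y) c := by
  induction c with
  | zero => rfl
  | succ c ih => simp [engelWord, ih]

theorem isEngelElement_one {G : Type*} [Group G] : IsEngelElement (1 : G) := by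
  refine fun g => ⟨1, fun c hc => ?_⟩
  obtain ⟨c, rfl⟩ := Nat.exists_eq_add_of_le' hc
  simp [engelWord]

open GuptaSidki in
theorem mainTheorem2 (h : GuptaSidki.Γ) : IsEngelElement h ↔ h = 1 := by
  refine ⟨fun hE => ?_, fun h1 => h1 ▸ isEngelElement_one⟩
  by_contra h1
  obtain ⟨φ, hφ, hmem, hconj⟩ := shifts_of_mem h.2 fun hh => h1 (Subtype.ext hh)
  -- Starting from the third iterate puts the test element in `Γ`; its `N`-th Engel word is then the
  -- image of iterate `N + 3`.
  obtain ⟨N, hN⟩ := hE ⟨φ (shiftCommutator^[3] recurrentTriple),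
    derived_le (hmem _ shiftCommutator_cube_recurrentTriple_mem)⟩
  have h2 := congrArg Γ.subtype (hN N le_rfl)
  rw [map_engelWord, map_one] at h2
  have h3 := (engelWord_shift hconj _ N).symm.trans h2
  rw [← Function.iterate_add_apply] at h3
  exact iterate_shiftCommutator_recurrentTriple_ne_one _ (hφ (h3.trans (map_one φ).symm))
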